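/- Let $G=(V,E)$ be a locally finite, connected (finite or infinite) graph with symmetric edge weights $w_{xy}\ge 0$, $w_{xy}>0$ if and only if $x\sim y$, bounded away from $0$ on edges, and let $m:V\to(0,\infty)$ be a measure on $V$. Put $\deg(x)=\sum_y w_{xy}$ and assume $D_m:=\sup_x \deg(x)/m(x)<\infty$. Let $\Delta f(x)=\frac1{m(x)}\sum_y w_{xy}(f(y)-f(x))$, let $\mu$ be the greatest lower bound of the spectrum of $-\Delta$ on $\ell^2(V,m)$, and let $p_t(x,y)$ be the minimal heat kernel, i.e. the limit of the Dirichlet heat kernels $p_t(x,y,\Omega)$ along exhaustions of $V$ by finite sets $\Omega$, where $t\mapsto p_t(\cdot,y,\Omega)$ solves $\partial_t u=\Delta u$ on $\Omega$, $u=0$ off $\Omega$, with initial value $\delta_y/m(y)$. Write $d(B_1,B_2)=\inf_{x\in B_1,y\in B_2}d(x,y)$ for the combinatorial distance of nonempty sets $B_1,B_2\subset V$, and $m(B)=\sum_{x\in B}m(x)\in[0,\infty]$. Let $\beta>0$. For every $0<\gamma<1$ there is a constant $C_3=C_3(\gamma,\beta,D_m)>0$, depending only on $\gamma,\beta,D_m$,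 such that for all $B_1,B_2\subset V$ and all $t\ge\max\{\beta\, d(B_1,B_2),1\}$, $$\sum_{x\in B_1}\sum_{y\in B_2}p_t(x,y)m(x)m(y)\le e^{-(1-\gamma)\mu t}\sqrt{m(B_1)m(B_2)}\,\exp\Big(-C_3\frac{d^2(B_1,B_2)}{4t}\Big).$$ Moreover, for all $B_1,B_2\subset V$ and all $t\ge\beta\, d(B_1,B_2)$, $$\sum_{x\in B_1}\sum_{y\in B_2}p_t(x,y)m(x)m(y)\le \sqrt{m(B_1)m(B_2)}\,\exp\Big(-C\frac{d^2(B_1,B_2)}{4t}\Big),\qquad C=\beta\,\mathrm{arcsinh}\Big(\frac1{D_m\beta}\Big)$$ (when $t=0$, hence $d(B_1,B_2)=0$, the exponent is read as $0$; when $D_m=0$, i.e. $V$ is one point without a loop, $d(B_1,B_2)=0$ and the value of $C$ is irrelevant). -/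

import Mathlib

open MeasureTheory Filter Topology
open scoped ENNReal

universe u

/-- A locally finite, connected weighted graph with vertex set `V`, together with a measure `m` on
the vertices. Two vertices `x`, `y` are neighbours iff `w x y > 0` (loops are allowed: they do not
affect the Laplacian, but count in the degree). -/
structure WeightedGraph (V : Type u) where
  /-- the edge weights -/
  w : V → V → ℝ
  w_nonneg : ∀ x y, 0 ≤ w x y
  w_symm : ∀ x y, w x y = w y x
  /-- the graph is locally finite -/
  locallyFinite : ∀ x, {y | 0 < w x y}.Finite
  /-- the graph is connected -/
  connected : (SimpleGraph.fromRel fun x y => 0 < w x y).Connected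
  /-- the edge weights are bounded away from zero -/
  w_min_pos : ∃ c : ℝ, 0 < c ∧ ∀ x y, 0 < w x y → c ≤ w x y
  /-- the vertex measure -/
  m : V → ℝ
  m_pos : ∀ x, 0 < m x
  /-- `D_m = sup_x deg(x) / m(x)` is finite -/
  bddAbove_Dm : BddAbove (Set.range fun x => (∑' y, w x y) / m x)

namespace WeightedGraph

variable {V : Type u} (G : WeightedGraph V)

/-- The underlying simple graph (loops removed); it carries the combinatorial distance. -/
def graph : SimpleGraph V := SimpleGraph.fromRel fun x y => 0 < G.w x y

/-- The combinatorial distance `d(B₁, B₂) = inf {d(x, y) | x ∈ B₁, y ∈ B₂}` of two nonempty sets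
(it is given the value `0` if one of the sets is empty). -/
noncomputable def setDist (B₁ B₂ : Set V) : ℕ :=
  sInf {n | ∃ x ∈ B₁, ∃ y ∈ B₂, G.graph.dist x y = n}

/-- The weighted degree (a finite sum, by local finiteness). -/
noncomputable def deg (x : V) : ℝ := ∑' y, G.w x y

/-- `D_m = sup_x deg(x) / m(x)`. -/
noncomputable def Dm : ℝ := ⨆ x, G.deg x / G.m x

/-- The Laplacian on arbitrary functions (a finite sum, by local finiteness). -/
noncomputable def laplacian (f : V → ℝ) (x : V) : ℝ :=
  (∑' y, G.w x y * (f y - f x)) / G.m x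

lemma w_support_finite (x : V) : (Function.support (G.w x)).Finite :=
  (G.locallyFinite x).subset fun y hy => lt_of_le_of_ne (G.w_nonneg x y) (Ne.symm hy)

lemma summable_w_mul (x : V) (g : V → ℝ) : Summable fun y => G.w x y * g y := by
  apply summable_of_hasFiniteSupport
  exact (G.w_support_finite x).subset fun y hy h => hy (by simp [h])

lemma summable_w (x : V) : Summable (G.w x) :=
  summable_of_hasFiniteSupport (G.w_support_finite x)

lemma deg_nonneg (x : V) : 0 ≤ G.deg x := tsum_nonneg (G.w_nonneg x)

lemma deg_div_le (x : V) : G.deg x / G.m x ≤ G.Dm := le_ciSup G.bddAbove_Dm x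

lemma deg_le (x : V) : G.deg x ≤ G.Dm * G.m x :=
  (div_le_iff₀ (G.m_pos x)).1 (G.deg_div_le x)

lemma Dm_nonneg : 0 ≤ G.Dm := by
  obtain ⟨x⟩ := G.connected.nonempty
  exact (div_nonneg (G.deg_nonneg x) (G.m_pos x).le).trans (G.deg_div_le x)

lemma laplacian_sq_le (f : V → ℝ) (x : V) :
    G.m x * G.laplacian f x ^ 2 ≤ G.Dm * ∑' y, G.w x y * (2 * (f y ^ 2 + f x ^ 2)) := by
  set s := (G.w_support_finite x).toFinset
  have hs : ∀ g : V → ℝ, ∑' y, G.w x y * g y = ∑ y ∈ s, G.w x y * g y := fun g =>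
    tsum_eq_sum fun y hy => by
      have : G.w x y = 0 := by simpa [s] using hy
      simp [this]
  have hd : G.deg x = ∑ y ∈ s, G.w x y := by
    have := hs fun _ => 1
    simpa [deg] using this
  have hm := G.m_pos x
  have h1 : (∑ y ∈ s, G.w x y * (f y - f x)) ^ 2
      ≤ (∑ y ∈ s, G.w x y) * ∑ y ∈ s, G.w x y * (f y - f x) ^ 2 := by
    apply Finset.sum_sq_le_sum_mul_sum_of_sq_le_mul
    · intro y _; exact G.w_nonneg x y
    · intro y _; exact mul_nonneg (G.w_nonneg x y) (sq_nonneg _)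
    · intro y _; exact le_of_eq (by ring)
  have h2 : ∑ y ∈ s, G.w x y * (f y - f x) ^ 2
      ≤ ∑ y ∈ s, G.w x y * (2 * (f y ^ 2 + f x ^ 2)) :=
    Finset.sum_le_sum fun y _ =>
      mul_le_mul_of_nonneg_left (by nlinarith [sq_nonneg (f y + f x)]) (G.w_nonneg x y)
  have h3 : 0 ≤ ∑ y ∈ s, G.w x y * (2 * (f y ^ 2 + f x ^ 2)) :=
    Finset.sum_nonneg fun y _ => mul_nonneg (G.w_nonneg x y) (by positivity)
  rw [laplacian, hs, hs]
  have e : G.m x * ((∑ y ∈ s, G.w x y * (f y - f x)) / G.m x) ^ 2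
      = (∑ y ∈ s, G.w x y * (f y - f x)) ^ 2 / G.m x := by
    field_simp
  rw [e, div_le_iff₀ hm]
  calc _ ≤ _ := h1
    _ ≤ G.deg x * ∑ y ∈ s, G.w x y * (2 * (f y ^ 2 + f x ^ 2)) := by
        rw [← hd]; exact mul_le_mul_of_nonneg_left h2 (G.deg_nonneg x)
    _ ≤ (G.Dm * G.m x) * ∑ y ∈ s, G.w x y * (2 * (f y ^ 2 + f x ^ 2)) :=
        mul_le_mul_of_nonneg_right (G.deg_le x) h3
    _ = _ := by ring

lemma ofReal_deg (x : V) : ENNReal.ofReal (G.deg x) = ∑' y, ENNReal.ofReal (G.w x y) :=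
  ENNReal.ofReal_tsum_of_nonneg (G.w_nonneg x) (G.summable_w x)

lemma laplacian_add (f g : V → ℝ) : G.laplacian (f + g) = G.laplacian f + G.laplacian g := by
  funext x
  simp only [laplacian, Pi.add_apply]
  rw [← add_div, ← (G.summable_w_mul x _).tsum_add (G.summable_w_mul x _)]
  congr 1
  exact tsum_congr fun y => by ring

lemma laplacian_smul (c : ℝ) (f : V → ℝ) : G.laplacian (c • f) = c • G.laplacian f := by
  funext x
  simp only [laplacian, Pi.smul_apply, smul_eq_mul]
  rw [← mul_div_assoc, ← tsum_mul_left]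
  congr 1
  exact tsum_congr fun y => by ring

/-! ### The Laplacian on `ℓ²(V, m)` and the bottom of its spectrum -/

section L2

variable [MeasurableSpace V]

/-- The measure on `V` with point masses `m`. -/
noncomputable def measure : Measure V :=
  Measure.sum fun x => ENNReal.ofReal (G.m x) • Measure.dirac x

variable [DiscreteMeasurableSpace V]

lemma lintegral_measure (f : V → ℝ≥0∞) :
    ∫⁻ x, f x ∂G.measure = ∑' x, ENNReal.ofReal (G.m x) * f x := by
  simp [measure, lintegral_sum_measure, lintegral_smul_measure,
    lintegral_dirac' _ (Measurable.of_discrete (f := f))]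

lemma eq_of_ae_eq {f g : V → ℝ} (h : f =ᵐ[G.measure] g) : f = g := by
  funext x
  by_contra hx
  have h0 : G.measure {y | f y ≠ g y} = 0 := ae_iff.1 h
  have h1 : G.measure {x} = 0 := measure_mono_null (by simpa using hx) h0
  rw [measure, Measure.sum_apply _ (MeasurableSet.of_discrete), ENNReal.tsum_eq_zero] at h1
  have := h1 x
  simp at this
  exact absurd (G.m_pos x) (not_lt.2 this)

lemma eLpNorm_sq (f : V → ℝ) :
    eLpNorm f 2 G.measure ^ (2 : ℝ)
      = ∑' x, ENNReal.ofReal (G.m x) * ENNReal.ofReal (f x ^ 2) := by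
  rw [eLpNorm_eq_lintegral_rpow_enorm_toReal (by norm_num) (by norm_num), ← ENNReal.rpow_mul,
    lintegral_measure]
  simp only [ENNReal.toReal_ofNat, one_div, ne_eq, OfNat.ofNat_ne_zero, not_false_eq_true,
    inv_mul_cancel₀, ENNReal.rpow_one]
  refine tsum_congr fun x => ?_
  congr 1
  rw [← sq_abs, ENNReal.ofReal_pow (abs_nonneg _), ← Real.norm_eq_abs, ofReal_norm]
  norm_num

lemma eLpNorm_laplacian_le (f : V → ℝ) :
    eLpNorm (G.laplacian f) 2 G.measure
      ≤ ENNReal.ofReal (2 * G.Dm) * eLpNorm f 2 G.measure := by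
  rw [← ENNReal.rpow_le_rpow_iff (z := 2) (by norm_num), ENNReal.mul_rpow_of_nonneg _ _ (by norm_num),
    eLpNorm_sq, eLpNorm_sq]
  have hD := G.Dm_nonneg
  set Q : ℝ≥0∞ := ∑' x, ENNReal.ofReal (G.m x) * ENNReal.ofReal (f x ^ 2) with hQ
  have hdeg : ∑' x, ENNReal.ofReal (G.deg x) * ENNReal.ofReal (f x ^ 2)
      ≤ ENNReal.ofReal G.Dm * Q := by
    rw [hQ, ← ENNReal.tsum_mul_left]
    refine ENNReal.tsum_le_tsum fun x => ?_
    rw [← mul_assoc, ← ENNReal.ofReal_mul hD]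
    gcongr
    exact G.deg_le x
  have e1 : ∑' x, ∑' y, ENNReal.ofReal (G.w x y) * ENNReal.ofReal (f x ^ 2)
      ≤ ENNReal.ofReal G.Dm * Q := by
    refine le_trans (le_of_eq (tsum_congr fun x => ?_)) hdeg
    rw [ENNReal.tsum_mul_right, ofReal_deg]
  have e2 : ∑' x, ∑' y, ENNReal.ofReal (G.w x y) * ENNReal.ofReal (f y ^ 2)
      ≤ ENNReal.ofReal G.Dm * Q := by
    rw [ENNReal.tsum_comm]
    refine le_trans (le_of_eq (tsum_congr fun x => tsum_congr fun y => ?_)) e1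
    rw [G.w_symm]
  have step : ∀ x, ENNReal.ofReal (G.m x) * ENNReal.ofReal (G.laplacian f x ^ 2)
      ≤ ENNReal.ofReal G.Dm * (2 * ∑' y, (ENNReal.ofReal (G.w x y) * ENNReal.ofReal (f y ^ 2)
        + ENNReal.ofReal (G.w x y) * ENNReal.ofReal (f x ^ 2))) := by
    intro x
    rw [← ENNReal.ofReal_mul (G.m_pos x).le]
    refine (ENNReal.ofReal_le_ofReal (G.laplacian_sq_le f x)).trans (le_of_eq ?_)
    rw [ENNReal.ofReal_mul hD, ENNReal.ofReal_tsum_of_nonneg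
      (fun y => mul_nonneg (G.w_nonneg x y) (by positivity)) (G.summable_w_mul x _),
      ← ENNReal.tsum_mul_left (a := 2)]
    congr 1
    refine tsum_congr fun y => ?_
    rw [ENNReal.ofReal_mul (G.w_nonneg x y), ENNReal.ofReal_mul (by norm_num),
      ENNReal.ofReal_add (sq_nonneg _) (sq_nonneg _), ENNReal.ofReal_ofNat]
    ring
  calc _ ≤ _ := ENNReal.tsum_le_tsum step
    _ = ENNReal.ofReal G.Dm * (2 * ((∑' x, ∑' y, ENNReal.ofReal (G.w x y) * ENNReal.ofReal (f y ^ 2))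
        + ∑' x, ∑' y, ENNReal.ofReal (G.w x y) * ENNReal.ofReal (f x ^ 2))) := by
        rw [ENNReal.tsum_mul_left, ENNReal.tsum_mul_left]
        simp_rw [ENNReal.tsum_add]
    _ ≤ ENNReal.ofReal G.Dm * (2 * (ENNReal.ofReal G.Dm * Q + ENNReal.ofReal G.Dm * Q)) := by
        gcongr
    _ = _ := by
        rw [ENNReal.ofReal_mul (by norm_num), ENNReal.ofReal_ofNat, ENNReal.rpow_two]
        ring

lemma memLp_laplacian {f : V → ℝ} (hf : MemLp f 2 G.measure) :
    MemLp (G.laplacian f) 2 G.measure :=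
  ⟨(Measurable.of_discrete).aestronglyMeasurable,
    (G.eLpNorm_laplacian_le f).trans_lt (ENNReal.mul_lt_top ENNReal.ofReal_lt_top hf.2)⟩

/-- The Laplacian `Δ` as a bounded operator on the real Hilbert space `ℓ²(V, m)`. -/
noncomputable def laplacianL2 : Lp ℝ 2 G.measure →L[ℝ] Lp ℝ 2 G.measure :=
  LinearMap.mkContinuous
    { toFun := fun f => (G.memLp_laplacian (Lp.memLp f)).toLp (G.laplacian f)
      map_add' := fun f g => by
        have h : ((f + g : Lp ℝ 2 G.measure) : V → ℝ) = f + g := G.eq_of_ae_eq (Lp.coeFn_add f g)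
        rw [← MemLp.toLp_add]
        congr 1
        rw [h, laplacian_add]
      map_smul' := fun c f => by
        have h : ((c • f : Lp ℝ 2 G.measure) : V → ℝ) = c • f := G.eq_of_ae_eq (Lp.coeFn_smul c f)
        rw [RingHom.id_apply, ← MemLp.toLp_const_smul]
        congr 1
        rw [h, laplacian_smul] }
    (2 * G.Dm) (fun f => by
      have hD : 0 ≤ 2 * G.Dm := mul_nonneg zero_le_two G.Dm_nonneg
      change ‖(G.memLp_laplacian (Lp.memLp f)).toLp (G.laplacian f)‖ ≤ _
      rw [Lp.norm_toLp, Lp.norm_def, ← ENNReal.toReal_ofReal hD, ← ENNReal.toReal_mul]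
      exact ENNReal.toReal_mono
        (ENNReal.mul_ne_top ENNReal.ofReal_ne_top (Lp.eLpNorm_ne_top f)) (G.eLpNorm_laplacian_le f))

lemma laplacianL2_apply (f : Lp ℝ 2 G.measure) : (G.laplacianL2 f : V → ℝ) = G.laplacian f :=
  G.eq_of_ae_eq (MemLp.coeFn_toLp (G.memLp_laplacian (Lp.memLp f)))

/-- The greatest lower bound of the `ℓ²`-spectrum of the (nonnegative) Laplacian `-Δ`. -/
noncomputable def spectralBottom : ℝ := sInf (spectrum ℝ (-G.laplacianL2))

end L2

/-! ### The minimal heat kernel -/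

section HeatKernel

open scoped Classical in
/-- The matrix of the Dirichlet Laplacian `Δ_Ω` of a finite set `Ω`: the Laplacian applied to
functions on `Ω` extended by zero, and restricted to `Ω`. -/
noncomputable def dirichletLaplacian (Ω : Finset V) : Matrix Ω Ω ℝ :=
  Matrix.of fun x y => (G.w x y - if x = y then G.deg x else 0) / G.m x

open scoped Classical in
/-- The Dirichlet heat kernel `p_t(x, y, Ω)` of a finite set `Ω`: the solution `exp(t Δ_Ω)` of
the Dirichlet heat equation on `Ω` with initial value `δ_y / m(y)`, and zero off `Ω`. -/
noncomputable def dirichletHeatKernel (Ω : Finset V) (t : ℝ) (x y : V) : ℝ :=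
  if h : x ∈ Ω ∧ y ∈ Ω then
    NormedSpace.exp (t • G.dirichletLaplacian Ω) ⟨x, h.1⟩ ⟨y, h.2⟩ / G.m y
  else 0

lemma dirichletLaplacian_mulVec (Ω : Finset V) (f : V → ℝ) (hf : ∀ x ∉ Ω, f x = 0) (x : Ω) :
    (G.dirichletLaplacian Ω).mulVec (fun y : Ω => f y) x = G.laplacian f x := by
  classical
  have h1 : ∑' y, G.w x y * f y = ∑ y : Ω, G.w x y * f y := by
    rw [tsum_eq_sum (s := Ω) fun y hy => by simp [hf y hy], ← Finset.sum_coe_sort Ω]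
  have h2 : ∑' y, G.w x y * (f y - f x) = ∑ y : Ω, G.w x y * f y - G.deg x * f x := by
    rw [← h1, deg, ← tsum_mul_right,
      ← (G.summable_w_mul x f).tsum_sub (G.summable_w_mul x fun _ => f x)]
    exact tsum_congr fun y => by ring
  rw [laplacian, h2]
  simp only [Matrix.mulVec, dotProduct, dirichletLaplacian, Matrix.of_apply]
  rw [sub_div, Finset.sum_div]
  simp only [sub_div, sub_mul, Finset.sum_sub_distrib, ite_div, zero_div, ite_mul, zero_mul,
    Finset.sum_ite_eq, Finset.mem_univ, if_true]
  congr 1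
  · exact Finset.sum_congr rfl fun y _ => by ring
  · ring

open scoped Matrix.Norms.Operator in
/-- The Dirichlet heat kernel solves the Dirichlet heat equation on `Ω`. -/
lemma hasDerivAt_dirichletHeatKernel (Ω : Finset V) (t : ℝ) {x : V} (hx : x ∈ Ω) (y : V) :
    HasDerivAt (fun s => G.dirichletHeatKernel Ω s x y)
      (G.laplacian (fun z => G.dirichletHeatKernel Ω t z y) x) t := by
  classical
  rw [← G.dirichletLaplacian_mulVec Ω (fun z => G.dirichletHeatKernel Ω t z y)
    (fun z hz => by simp [dirichletHeatKernel, hz]) ⟨x, hx⟩]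
  by_cases hy : y ∈ Ω
  · have h := hasDerivAt_exp_smul_const' (𝕂 := ℝ) (G.dirichletLaplacian Ω) t
    have h1 : HasDerivAt (fun s => NormedSpace.exp (s • G.dirichletLaplacian Ω) ⟨x, hx⟩ ⟨y, hy⟩)
        ((G.dirichletLaplacian Ω * NormedSpace.exp (t • G.dirichletLaplacian Ω))
          ⟨x, hx⟩ ⟨y, hy⟩) t :=
      hasDerivAt_pi.1 (hasDerivAt_pi.1 h ⟨x, hx⟩) ⟨y, hy⟩
    have h2 := h1.div_const (G.m y)
    have e1 : (fun s => G.dirichletHeatKernel Ω s x y) = fun s =>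
        NormedSpace.exp (s • G.dirichletLaplacian Ω) ⟨x, hx⟩ ⟨y, hy⟩ / G.m y := by
      funext s; simp [dirichletHeatKernel, hx, hy]
    have e2 : (G.dirichletLaplacian Ω).mulVec (fun z : Ω => G.dirichletHeatKernel Ω t z y) ⟨x, hx⟩
        = (G.dirichletLaplacian Ω * NormedSpace.exp (t • G.dirichletLaplacian Ω))
          ⟨x, hx⟩ ⟨y, hy⟩ / G.m y := by
      simp [Matrix.mulVec, dotProduct, Matrix.mul_apply, dirichletHeatKernel, hy,
        Finset.sum_div, mul_div_assoc]
    rw [e1, e2]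
    exact h2
  · simp only [dirichletHeatKernel, hy, and_false, dite_false]
    have e : (G.dirichletLaplacian Ω).mulVec (fun _ : Ω => (0 : ℝ)) ⟨x, hx⟩ = 0 := by
      simp [Matrix.mulVec, dotProduct]
    rw [e]
    exact hasDerivAt_const t (0 : ℝ)

open scoped Classical in
/-- The Dirichlet heat kernel has the initial value `δ_y / m(y)`. -/
lemma dirichletHeatKernel_zero (Ω : Finset V) {x y : V} (hx : x ∈ Ω) :
    G.dirichletHeatKernel Ω 0 x y = if x = y then 1 / G.m y else 0 := by
  by_cases hy : y ∈ Ω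
  · simp only [dirichletHeatKernel, hx, hy, and_self, dite_true, zero_smul,
      NormedSpace.exp_zero, Matrix.one_apply, Subtype.mk.injEq]
    split_ifs <;> simp
  · have : x ≠ y := fun h => hy (h ▸ hx)
    simp [dirichletHeatKernel, hy, this]

open scoped Classical in
/-- `Δ_Ω + D_m`, a matrix with nonnegative entries. -/
noncomputable def dirichletShift (Ω : Finset V) : Matrix Ω Ω ℝ :=
  G.dirichletLaplacian Ω + G.Dm • (1 : Matrix Ω Ω ℝ)

lemma dirichletShift_apply_nonneg (Ω : Finset V) (x y : Ω) : 0 ≤ G.dirichletShift Ω x y := by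
  classical
  have hm := G.m_pos x
  have h1 := G.deg_div_le x
  have h2 : 0 ≤ G.w x y / G.m x := div_nonneg (G.w_nonneg _ _) hm.le
  simp only [dirichletShift, dirichletLaplacian, Matrix.add_apply, Matrix.of_apply,
    Matrix.smul_apply, Matrix.one_apply, smul_eq_mul, sub_div]
  split_ifs
  · linarith
  · simpa using h2

open scoped Classical in
lemma dirichletShift_pow_nonneg (Ω : Finset V) (n : ℕ) :
    ∀ x y : Ω, 0 ≤ (G.dirichletShift Ω ^ n) x y := by
  induction n with
  | zero => intro x y; rw [pow_zero, Matrix.one_apply]; split_ifs <;> simp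
  | succ n ih =>
    intro x y
    rw [pow_succ, Matrix.mul_apply]
    exact Finset.sum_nonneg fun z _ => mul_nonneg (ih x z) (G.dirichletShift_apply_nonneg Ω z y)

lemma sum_dirichletShift_le (Ω : Finset V) (x : Ω) : ∑ y, G.dirichletShift Ω x y ≤ G.Dm := by
  classical
  have hm := G.m_pos x
  have h : ∑ y : Ω, G.w x y ≤ G.deg x := by
    rw [Finset.sum_coe_sort Ω fun y => G.w x y]
    exact (G.summable_w x).sum_le_tsum _ fun y _ => G.w_nonneg x y
  have h2 := (div_le_div_iff_of_pos_right hm).2 h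
  simp only [dirichletShift, dirichletLaplacian, Matrix.add_apply, Matrix.of_apply,
    Matrix.smul_apply, Matrix.one_apply, smul_eq_mul, sub_div, ite_div, zero_div, mul_ite, mul_one,
    mul_zero, Finset.sum_add_distrib, Finset.sum_sub_distrib, Finset.sum_ite_eq, Finset.mem_univ,
    if_true, ← Finset.sum_div]
  linarith

open scoped Classical in
lemma dirichletShift_pow_le (Ω : Finset V) (n : ℕ) :
    ∀ x y : Ω, (G.dirichletShift Ω ^ n) x y ≤ G.Dm ^ n := by
  induction n with
  | zero => intro x y; rw [pow_zero, Matrix.one_apply]; split_ifs <;> simp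
  | succ n ih =>
    intro x y
    rw [pow_succ', Matrix.mul_apply]
    calc _ ≤ ∑ z, G.dirichletShift Ω x z * G.Dm ^ n := Finset.sum_le_sum fun z _ =>
          mul_le_mul_of_nonneg_left (ih z y) (G.dirichletShift_apply_nonneg Ω x z)
      _ ≤ G.Dm * G.Dm ^ n := by
          rw [← Finset.sum_mul]
          exact mul_le_mul_of_nonneg_right (G.sum_dirichletShift_le Ω x)
            (pow_nonneg G.Dm_nonneg n)
      _ = _ := by ring

open scoped Classical in
lemma dirichletShift_pow_mono {Ω Ω' : Finset V} (h : Ω ⊆ Ω') (n : ℕ) :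
    ∀ x y : Ω, (G.dirichletShift Ω ^ n) x y
      ≤ (G.dirichletShift Ω' ^ n) ⟨x, h x.2⟩ ⟨y, h y.2⟩ := by
  induction n with
  | zero => intro x y; simp only [pow_zero, Matrix.one_apply, Subtype.mk.injEq]; simp
  | succ n ih =>
    intro x y
    rw [pow_succ, Matrix.mul_apply, pow_succ, Matrix.mul_apply]
    have he : ∀ z : Ω, G.dirichletShift Ω z y
        = G.dirichletShift Ω' ⟨z, h z.2⟩ ⟨y, h y.2⟩ := fun z => by
      have hz : ((⟨z, h z.2⟩ : Ω') = ⟨y, h y.2⟩) = (z = y) := by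
        rw [Subtype.mk.injEq, Subtype.coe_inj]
      simp only [dirichletShift, dirichletLaplacian, Matrix.add_apply, Matrix.of_apply,
        Matrix.smul_apply, Matrix.one_apply, hz]
    calc _ ≤ ∑ z : Ω, (G.dirichletShift Ω' ^ n) ⟨x, h x.2⟩ ⟨z, h z.2⟩
            * G.dirichletShift Ω' ⟨z, h z.2⟩ ⟨y, h y.2⟩ := Finset.sum_le_sum fun z _ => by
          rw [← he]
          exact mul_le_mul_of_nonneg_right (ih x z) (G.dirichletShift_apply_nonneg Ω z y)
      _ = ∑ z ∈ Finset.univ.map ⟨fun z : Ω => (⟨z, h z.2⟩ : Ω'), fun a b hab => by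
            exact Subtype.ext (congrArg (fun z : Ω' => (z : V)) hab)⟩, (G.dirichletShift Ω' ^ n) ⟨x, h x.2⟩ z
            * G.dirichletShift Ω' z ⟨y, h y.2⟩ := by rw [Finset.sum_map]; rfl
      _ ≤ _ := Finset.sum_le_sum_of_subset_of_nonneg (Finset.subset_univ _) fun z _ _ =>
          mul_nonneg (G.dirichletShift_pow_nonneg Ω' n _ _) (G.dirichletShift_apply_nonneg Ω' _ _)

open scoped Classical Matrix.Norms.Operator in
lemma hasSum_exp_dirichletLaplacian (Ω : Finset V) (t : ℝ) (x y : Ω) :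
    HasSum (fun n : ℕ => Real.exp (-(t * G.Dm)) *
        ((n.factorial : ℝ)⁻¹ * t ^ n * (G.dirichletShift Ω ^ n) x y))
      (NormedSpace.exp (t • G.dirichletLaplacian Ω) x y) := by
  have e : t • G.dirichletLaplacian Ω
      = algebraMap ℝ (Matrix Ω Ω ℝ) (-(t * G.Dm)) + t • G.dirichletShift Ω := by
    rw [dirichletShift, smul_add, Algebra.algebraMap_eq_smul_one, smul_smul, neg_smul]
    abel
  have h1 : NormedSpace.exp (t • G.dirichletLaplacian Ω)
      = Real.exp (-(t * G.Dm)) • NormedSpace.exp (t • G.dirichletShift Ω) := by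
    have hc : Commute (algebraMap ℝ (Matrix Ω Ω ℝ) (-(t * G.Dm))) (t • G.dirichletShift Ω) :=
      Algebra.commutes _ _
    have hs : NormedSpace.exp (algebraMap ℝ (Matrix Ω Ω ℝ) (-(t * G.Dm)))
        = algebraMap ℝ (Matrix Ω Ω ℝ) (NormedSpace.exp (-(t * G.Dm))) := by
      rw [Matrix.algebraMap_eq_diagonal, Matrix.algebraMap_eq_diagonal, Matrix.exp_diagonal]
      congr 1
      funext i
      simp [Pi.coe_exp]
    rw [e, Matrix.exp_add_of_commute _ _ hc, hs, ← Real.exp_eq_exp_ℝ, Algebra.algebraMap_eq_smul_one,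
      smul_mul_assoc, one_mul]
  have h2 := NormedSpace.exp_series_hasSum_exp' (𝕂 := ℝ) (t • G.dirichletShift Ω)
  have h3 := Pi.hasSum.1 (Pi.hasSum.1 h2 x) y
  rw [h1]
  refine (h3.mul_left (Real.exp (-(t * G.Dm)))).congr_fun ?_
  intro n
  simp [smul_pow, mul_assoc]

lemma dirichletHeatKernel_nonneg (Ω : Finset V) {t : ℝ} (ht : 0 ≤ t) (x y : V) :
    0 ≤ G.dirichletHeatKernel Ω t x y := by
  rw [dirichletHeatKernel]
  split_ifs with h
  · refine div_nonneg ((G.hasSum_exp_dirichletLaplacian Ω t _ _).nonneg fun n => ?_) (G.m_pos y).le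
    have := G.dirichletShift_pow_nonneg Ω n ⟨x, h.1⟩ ⟨y, h.2⟩
    positivity
  · exact le_rfl

lemma dirichletHeatKernel_le (Ω : Finset V) {t : ℝ} (ht : 0 ≤ t) (x y : V) :
    G.dirichletHeatKernel Ω t x y ≤ 1 / G.m y := by
  have hm := G.m_pos y
  rw [dirichletHeatKernel]
  split_ifs with h
  · rw [div_le_div_iff_of_pos_right hm]
    have h1 : HasSum (fun n : ℕ => Real.exp (-(t * G.Dm)) *
        ((n.factorial : ℝ)⁻¹ * t ^ n * G.Dm ^ n)) 1 := by
      have h2 := (NormedSpace.exp_series_hasSum_exp' (𝕂 := ℝ) (t * G.Dm)).mul_left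
        (Real.exp (-(t * G.Dm)))
      rw [← Real.exp_eq_exp_ℝ, ← Real.exp_add, neg_add_cancel, Real.exp_zero] at h2
      refine h2.congr_fun fun n => ?_
      rw [smul_eq_mul, mul_pow]
      ring
    refine hasSum_le (fun n => ?_) (G.hasSum_exp_dirichletLaplacian Ω t _ _) h1
    have := G.dirichletShift_pow_le Ω n ⟨x, h.1⟩ ⟨y, h.2⟩
    gcongr
  · positivity

lemma dirichletHeatKernel_mono {t : ℝ} (ht : 0 ≤ t) (x y : V) :
    Monotone fun Ω : Finset V => G.dirichletHeatKernel Ω t x y := by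
  intro Ω Ω' hΩ
  by_cases h : x ∈ Ω ∧ y ∈ Ω
  · have h' : x ∈ Ω' ∧ y ∈ Ω' := ⟨hΩ h.1, hΩ h.2⟩
    simp only [dirichletHeatKernel, h, h', and_self, dite_true]
    rw [div_le_div_iff_of_pos_right (G.m_pos y)]
    refine hasSum_le (fun n => ?_) (G.hasSum_exp_dirichletLaplacian Ω t _ _)
      (G.hasSum_exp_dirichletLaplacian Ω' t _ _)
    have := G.dirichletShift_pow_mono hΩ n ⟨x, h.1⟩ ⟨y, h.2⟩
    gcongr
  · simpa only [dirichletHeatKernel, h, dite_false] using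
      G.dirichletHeatKernel_nonneg Ω' ht x y

/-- The minimal heat kernel `p_t(x, y)`: the limit of the Dirichlet heat kernels as the finite
sets `Ω` exhaust `V`. -/
noncomputable def heatKernel (t : ℝ) (x y : V) : ℝ :=
  limUnder atTop fun Ω : Finset V => G.dirichletHeatKernel Ω t x y

lemma tendsto_heatKernel {t : ℝ} (ht : 0 ≤ t) (x y : V) :
    Tendsto (fun Ω : Finset V => G.dirichletHeatKernel Ω t x y) atTop (𝓝 (G.heatKernel t x y)) :=
  tendsto_nhds_limUnder ⟨_, tendsto_atTop_ciSup (G.dirichletHeatKernel_mono ht x y)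
    ⟨1 / G.m y, by rintro _ ⟨Ω, rfl⟩; exact G.dirichletHeatKernel_le Ω ht x y⟩⟩

/-- The limit defining the heat kernel exists and may be taken along any exhaustion of `V`. -/
lemma tendsto_heatKernel_of_exhaustion {t : ℝ} (ht : 0 ≤ t) (x y : V) (Ω : ℕ → Finset V)
    (hΩ : Monotone Ω) (hV : ∀ x, ∃ i, x ∈ Ω i) :
    Tendsto (fun i => G.dirichletHeatKernel (Ω i) t x y) atTop (𝓝 (G.heatKernel t x y)) :=
  (G.tendsto_heatKernel ht x y).comp (tendsto_atTop_finset_of_monotone hΩ hV)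

lemma heatKernel_nonneg {t : ℝ} (ht : 0 ≤ t) (x y : V) : 0 ≤ G.heatKernel t x y :=
  ge_of_tendsto' (G.tendsto_heatKernel ht x y) fun Ω => G.dirichletHeatKernel_nonneg Ω ht x y

end HeatKernel

end WeightedGraph

/-! The proof is Davies' method of exponential weights. Let `u` solve the Dirichlet heat equation on
a finite `Ω` from the indicator of a finite `F₂ ⊆ B₂`, and let `ρ` be the distance to `B₂`.
Conjugating `Δ` by `exp (l * ρ)` replaces `w x y` by `w x y * exp (l * (ρ x - ρ y))`; symmetrizing
turns the exponential into `cosh`, and since `ρ` changes by at most 1 along an edge the form grows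
by at most `Dm * (cosh l - 1)` (`sum_mul_laplacian_weighted_le`). Together with the variational
bound for `μ`, whose source is `sInf_spectrum_mul_le`, this controls the weighted energy in time
(`weighted_energy_le`).

The weight is 1 on `F₂` and at least `exp (l * d)` on `B₁`, so Cauchy-Schwarz gives the factor `exp
((-μ + Dm * (cosh l - 1)) * t - l * d)`, uniformly in `Ω` and in the finite subsets of `B₁`, `B₂`;
limits then give the bound for arbitrary sets.

Choosing `sinh l = d / (Dm * t)` makes the exponent at most `-μ * t - l * d / 2`, and the decrease
of `arsinh x / x` bounds `l` below by `C * d / t` when `t ≥ β * d` (`Real.exists_slope`). The full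
rate `μ` survives, so both claims follow from `μ ≥ 0`. -/

/-! ### Spectral bottom and Rayleigh quotients of a positive operator -/

section Spectrum

variable {E : Type*} [NormedAddCommGroup E] [InnerProductSpace ℝ E]

/-- The spectrum of a positive operator on a real Hilbert space is nonnegative. -/
lemma ContinuousLinearMap.IsPositive.nonneg_of_mem_spectrum [CompleteSpace E]
    {A : E →L[ℝ] E} (hA : A.IsPositive)
    {c : ℝ} (hc : c ∈ spectrum ℝ A) : 0 ≤ c :=
  SpectrumRestricts.nnreal_iff.1 hA.spectrumRestricts c hc

/-- The norm of a positive operator on a nontrivial real Hilbert space belongs to its spectrum. -/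
lemma ContinuousLinearMap.IsPositive.norm_mem_spectrum [Nontrivial E] {T : E →L[ℝ] E}
    (hT : T.IsPositive) : ‖T‖ ∈ spectrum ℝ T := by
  by_contra h
  -- A resolvent point at `‖T‖` keeps all Rayleigh quotients below `‖T‖ - ε`, but for a symmetric
  -- operator the supremum of their absolute values is `‖T‖`.
  obtain ⟨ε, hε, hT'⟩ := T.rayleighQuotient_le_of_norm_mem_resolventSet
    (by simpa [spectrum] using h)
  have h1 : ∀ x, |T.rayleighQuotient x| ≤ ‖T‖ - ε := fun x => by
    rw [abs_of_nonneg (div_nonneg (hT.2 x) (sq_nonneg _))]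
    exact hT' x
  have h2 := ciSup_le h1
  rw [← T.norm_eq_iSup_rayleighQuotient hT.isSymmetric] at h2
  linarith

/-- The greatest lower bound of the spectrum of a positive operator is a lower bound of its
Rayleigh quotients. -/
lemma ContinuousLinearMap.IsPositive.sInf_spectrum_mul_le [CompleteSpace E]
    {A : E →L[ℝ] E} (hA : A.IsPositive) (x : E) : sInf (spectrum ℝ A) * ‖x‖ ^ 2 ≤ inner ℝ (A x) x := by
  rcases subsingleton_or_nontrivial E with hE | hE
  · simp [Subsingleton.elim x 0]
  -- Reflecting the spectrum moves its bottom to the top: `‖T‖` lies in the spectrum of `T`, so `‖A‖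
  -- - ‖T‖` lies in that of `A`, and `⟪T x, x⟫ ≤ ‖T‖ * ‖x‖ ^ 2` is the claim rearranged.
  set T : E →L[ℝ] E := algebraMap ℝ _ ‖A‖ - A with hTdef
  have hTx : ∀ y, T y = ‖A‖ • y - A y := fun y => by
    simp [hTdef, Algebra.algebraMap_eq_smul_one]
  have hT : T.IsPositive := by
    refine ⟨fun y z => ?_, fun y => ?_⟩
    · have := hA.inner_left_eq_inner_right y z
      simp only [ContinuousLinearMap.coe_coe, hTx, inner_sub_left, inner_sub_right,
        real_inner_smul_left, real_inner_smul_right, this]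
    · change 0 ≤ inner ℝ (T y) y
      rw [hTx, inner_sub_left, real_inner_smul_left, real_inner_self_eq_norm_sq]
      have := (real_inner_le_norm (A y) y).trans
        (mul_le_mul_of_nonneg_right (A.le_opNorm y) (norm_nonneg y))
      nlinarith
  have h1 : ‖A‖ - ‖T‖ ∈ spectrum ℝ A := by
    have h := hT.norm_mem_spectrum
    rw [hTdef, ← spectrum.singleton_sub_eq] at h
    obtain ⟨a, ha, b, hb, hab⟩ := h
    rw [Set.mem_singleton_iff.1 ha] at hab
    have : ‖A‖ - ‖T‖ = b := by rw [hTdef, ← hab]; simp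
    rwa [this]
  have h2 : sInf (spectrum ℝ A) ≤ ‖A‖ - ‖T‖ :=
    csInf_le ⟨0, fun c hc => hA.nonneg_of_mem_spectrum hc⟩ h1
  have h3 := (real_inner_le_norm (T x) x).trans
    (mul_le_mul_of_nonneg_right (T.le_opNorm x) (norm_nonneg x))
  rw [hTx, inner_sub_left, real_inner_smul_left, real_inner_self_eq_norm_sq] at h3
  nlinarith [mul_le_mul_of_nonneg_right h2 (sq_nonneg ‖x‖)]

end Spectrum

namespace WeightedGraph

variable {V : Type u} (G : WeightedGraph V)

/-! ### The Dirichlet form and the variational bound for `μ` -/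

section Form

variable [MeasurableSpace V] [DiscreteMeasurableSpace V]

lemma hasSum_integral_measure {f : V → ℝ} (hf : Integrable f G.measure) :
    HasSum (fun x => G.m x * f x) (∫ x, f x ∂G.measure) := by
  refine (MeasureTheory.hasSum_integral_measure hf).congr_fun fun x => ?_
  rw [integral_smul_measure, integral_dirac' _ _ (Measurable.of_discrete.stronglyMeasurable),
    ENNReal.toReal_ofReal (G.m_pos x).le, smul_eq_mul]

lemma hasSum_inner (f g : Lp ℝ 2 G.measure) :
    HasSum (fun x => G.m x * (f x * g x)) (inner ℝ f g) := by
  have e : ∀ x, inner ℝ (f x) (g x) = f x * g x := fun x => mul_comm _ _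
  have h : Integrable (fun x => f x * g x) G.measure :=
    (L2.integrable_inner (𝕜 := ℝ) f g).congr (Eventually.of_forall e)
  rw [L2.inner_def, integral_congr_ae (Eventually.of_forall e)]
  exact G.hasSum_integral_measure h

lemma summable_deg_mul_sq (f : Lp ℝ 2 G.measure) : Summable fun x => G.deg x * f x ^ 2 := by
  refine Summable.of_nonneg_of_le (fun x => mul_nonneg (G.deg_nonneg x) (sq_nonneg _))
    (fun x => ?_) ((G.hasSum_inner f f).summable.mul_left G.Dm)
  have := mul_le_mul_of_nonneg_right (G.deg_le x) (sq_nonneg (f x))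
  nlinarith

lemma summable_prod_w_mul_sq (f : Lp ℝ 2 G.measure) :
    Summable fun p : V × V => G.w p.1 p.2 * f p.1 ^ 2 := by
  have h0 : (0 : V × V → ℝ) ≤ fun p => G.w p.1 p.2 * f p.1 ^ 2 := fun p =>
    mul_nonneg (G.w_nonneg p.1 p.2) (sq_nonneg (f p.1))
  refine (summable_prod_of_nonneg h0).2 ⟨fun x => (G.summable_w x).mul_right (f x ^ 2), ?_⟩
  refine (G.summable_deg_mul_sq f).congr fun x => ?_
  exact tsum_mul_right.symm

lemma summable_prod_w_mul_sq' (f : Lp ℝ 2 G.measure) :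
    Summable fun p : V × V => G.w p.1 p.2 * f p.2 ^ 2 := by
  refine ((Equiv.prodComm V V).summable_iff.2 (G.summable_prod_w_mul_sq f)).congr fun p => ?_
  simp [G.w_symm p.1 p.2]

/-- The Dirichlet form, not yet symmetrized. -/
lemma hasSum_inner_laplacianL2 (f g : Lp ℝ 2 G.measure) :
    HasSum (fun p : V × V => G.w p.1 p.2 * ((f p.2 - f p.1) * g p.1))
      (inner ℝ (G.laplacianL2 f) g) := by
  have hs : Summable fun p : V × V => G.w p.1 p.2 * ((f p.2 - f p.1) * g p.1) := by
    refine Summable.of_norm_bounded (((G.summable_prod_w_mul_sq' f).add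
      (G.summable_prod_w_mul_sq f)).add (G.summable_prod_w_mul_sq g)) fun p => ?_
    rw [Real.norm_eq_abs, abs_mul, abs_of_nonneg (G.w_nonneg _ _), ← mul_add, ← mul_add]
    refine mul_le_mul_of_nonneg_left (abs_le.2 ⟨?_, ?_⟩) (G.w_nonneg _ _)
    · nlinarith [sq_nonneg (f p.2 + f p.1), sq_nonneg (f p.2 - f p.1 + g p.1),
        sq_nonneg (g p.1), sq_nonneg (f p.2 - f p.1 + 2 * g p.1)]
    · nlinarith [sq_nonneg (f p.2 + f p.1), sq_nonneg (f p.2 - f p.1 - g p.1),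
        sq_nonneg (g p.1), sq_nonneg (f p.2 - f p.1 - 2 * g p.1)]
  -- Absolute summability over pairs allows summing over `y` first, which recovers `m x * Δf x * g
  -- x`.
  have h1 := hs.hasSum.prod_fiberwise fun x => (hs.prod_factor x).hasSum
  have h2 := G.hasSum_inner (G.laplacianL2 f) g
  have e : (fun x => ∑' y, G.w x y * ((f y - f x) * g x))
      = fun x => G.m x * (G.laplacianL2 f x * g x) := by
    funext x
    have hm := (G.m_pos x).ne'
    rw [congrFun (G.laplacianL2_apply f) x, laplacian]
    simp only [← mul_assoc, tsum_mul_right]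
    field_simp
  simp only [e] at h1
  rw [h2.unique h1]
  exact hs.hasSum

/-- Green's formula, by averaging the unsymmetrized sum with its image under `(x, y) ↦ (y, x)`. In
this form the self-adjointness and positivity of `-Δ` are visible. -/
lemma hasSum_inner_neg_laplacianL2 (f g : Lp ℝ 2 G.measure) :
    HasSum (fun p : V × V => G.w p.1 p.2 * ((f p.1 - f p.2) * (g p.1 - g p.2)) / 2)
      (inner ℝ ((-G.laplacianL2) f) g) := by
  have h1 := G.hasSum_inner_laplacianL2 f g
  have h2 := (Equiv.prodComm V V).hasSum_iff.2 h1
  have h3 := (h1.add h2).div_const (-2)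
  have e : inner ℝ ((-G.laplacianL2) f) g
      = (inner ℝ (G.laplacianL2 f) g + inner ℝ (G.laplacianL2 f) g) / (-2) := by
    rw [neg_apply, inner_neg_left]; ring
  rw [e]
  refine h3.congr_fun fun p => ?_
  simp only [Function.comp_apply, Equiv.prodComm_apply, Prod.fst_swap, Prod.snd_swap,
    G.w_symm p.2 p.1]
  ring

lemma isPositive_neg_laplacianL2 : (-G.laplacianL2).IsPositive := by
  refine ⟨fun f g => ?_, fun f => ?_⟩
  · change inner ℝ ((-G.laplacianL2) f) g = inner ℝ f ((-G.laplacianL2) g)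
    rw [real_inner_comm _ f]
    refine (G.hasSum_inner_neg_laplacianL2 f g).unique
      ((G.hasSum_inner_neg_laplacianL2 g f).congr_fun fun p => ?_)
    ring
  · refine (G.hasSum_inner_neg_laplacianL2 f f).nonneg fun p => ?_
    have := mul_nonneg (G.w_nonneg p.1 p.2) (mul_self_nonneg (f p.1 - f p.2))
    positivity

lemma spectralBottom_nonneg : 0 ≤ G.spectralBottom :=
  Real.sInf_nonneg fun _ hc => G.isPositive_neg_laplacianL2.nonneg_of_mem_spectrum hc

lemma memLp_of_support_subset {Ω : Finset V} {f : V → ℝ} (hf : ∀ x ∉ Ω, f x = 0) :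
    MemLp f 2 G.measure := by
  refine ⟨Measurable.of_discrete.aestronglyMeasurable, ?_⟩
  have h : eLpNorm f 2 G.measure ^ (2 : ℝ) < ∞ := by
    rw [eLpNorm_sq, tsum_eq_sum (s := Ω) fun x hx => by simp [hf x hx]]
    exact ENNReal.sum_lt_top.2 fun x _ => ENNReal.mul_lt_top ENNReal.ofReal_lt_top
      ENNReal.ofReal_lt_top
  exact (ENNReal.rpow_lt_top_iff_of_pos (by norm_num)).1 h

/-- The variational bound for `μ` on finitely supported functions. -/
lemma sum_mul_laplacian_le {Ω : Finset V} {f : V → ℝ} (hf : ∀ x ∉ Ω, f x = 0) :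
    ∑ x ∈ Ω, G.m x * (G.laplacian f x * f x)
      ≤ -G.spectralBottom * ∑ x ∈ Ω, G.m x * f x ^ 2 := by
  have hL := G.memLp_of_support_subset hf
  set F := hL.toLp f
  have hF : (F : V → ℝ) = f := G.eq_of_ae_eq hL.coeFn_toLp
  have h := G.isPositive_neg_laplacianL2.sInf_spectrum_mul_le F
  rw [neg_apply, inner_neg_left, ← real_inner_self_eq_norm_sq,
    ← (G.hasSum_inner _ _).tsum_eq, ← (G.hasSum_inner _ _).tsum_eq, laplacianL2_apply, hF,
    tsum_eq_sum (s := Ω) fun x hx => by simp [hf x hx],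
    tsum_eq_sum (s := Ω) fun x hx => by simp [hf x hx]] at h
  simp only [← sq] at h
  rw [spectralBottom]
  linarith

end Form

/-! ### The exponentially weighted form -/

section Energy

lemma m_mul_laplacian {Ω : Finset V} {f : V → ℝ} (hf : ∀ x ∉ Ω, f x = 0) (x : V) :
    G.m x * G.laplacian f x = ∑ y ∈ Ω, G.w x y * f y - G.deg x * f x := by
  have hm := (G.m_pos x).ne'
  have h1 : ∑' y, G.w x y * f y = ∑ y ∈ Ω, G.w x y * f y :=
    tsum_eq_sum fun y hy => by simp [hf y hy]
  rw [laplacian, mul_div_cancel₀ _ hm, ← h1, deg, ← tsum_mul_right,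
    ← (G.summable_w_mul x f).tsum_sub (G.summable_w_mul x fun _ => f x)]
  exact tsum_congr fun y => by ring

/-- Row sums of `w` are at most `deg x ≤ Dm * m x`; this is how `Dm` enters the energy estimate. -/
lemma sum_sum_w_mul_le (Ω : Finset V) {g : V → ℝ} (hg : ∀ x, 0 ≤ g x) :
    ∑ x ∈ Ω, ∑ y ∈ Ω, G.w x y * g x ≤ G.Dm * ∑ x ∈ Ω, G.m x * g x := by
  rw [Finset.mul_sum]
  refine Finset.sum_le_sum fun x _ => ?_
  rw [← Finset.sum_mul, ← mul_assoc]
  exact mul_le_mul_of_nonneg_right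
    (((G.summable_w x).sum_le_tsum _ fun y _ => G.w_nonneg x y).trans (G.deg_le x)) (hg x)

/-- Conjugating the Laplacian by the exponential of a function that varies by at most `l` along
edges costs at most `D_m (cosh l - 1)`. -/
lemma sum_mul_laplacian_weighted_le [MeasurableSpace V] [DiscreteMeasurableSpace V]
    {Ω : Finset V} {f : V → ℝ} (hf : ∀ x ∉ Ω, f x = 0) {φ : V → ℝ} {l : ℝ}
    (hφ : ∀ x y, 0 < G.w x y → |φ x - φ y| ≤ l) :
    ∑ x ∈ Ω, G.m x * (G.laplacian f x * f x * Real.exp (φ x) ^ 2)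
      ≤ (-G.spectralBottom + G.Dm * (Real.cosh l - 1))
        * ∑ x ∈ Ω, G.m x * (f x * Real.exp (φ x)) ^ 2 := by
  -- In terms of `v`, the weighted form differs from the plain form of `v` only by the factors `exp
  -- (φ x - φ y)` off the degree term.
  set v : V → ℝ := fun x => f x * Real.exp (φ x) with hv
  have hv0 : ∀ x ∉ Ω, v x = 0 := fun x hx => by simp [hv, hf x hx]
  have hμ := G.sum_mul_laplacian_le hv0
  have e1 : ∑ x ∈ Ω, G.m x * (G.laplacian f x * f x * Real.exp (φ x) ^ 2)
      = ∑ x ∈ Ω, ∑ y ∈ Ω, G.w x y * (Real.exp (φ x - φ y) * (v x * v y))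
        - ∑ x ∈ Ω, G.deg x * v x ^ 2 := by
    rw [← Finset.sum_sub_distrib]
    refine Finset.sum_congr rfl fun x _ => ?_
    rw [← mul_assoc, ← mul_assoc, G.m_mul_laplacian hf, sub_mul, sub_mul, Finset.sum_mul,
      Finset.sum_mul]
    congr 1
    · refine Finset.sum_congr rfl fun y _ => ?_
      have := (Real.exp_pos (φ y)).ne'
      rw [Real.exp_sub, hv]
      field_simp
    · rw [hv]; ring
  have e2 : ∑ x ∈ Ω, G.m x * (G.laplacian v x * v x)
      = ∑ x ∈ Ω, ∑ y ∈ Ω, G.w x y * (v x * v y) - ∑ x ∈ Ω, G.deg x * v x ^ 2 := by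
    rw [← Finset.sum_sub_distrib]
    refine Finset.sum_congr rfl fun x _ => ?_
    rw [← mul_assoc, G.m_mul_laplacian hv0, sub_mul, Finset.sum_mul]
    congr 1
    · exact Finset.sum_congr rfl fun y _ => by ring
    · ring
  -- Exchanging `x` and `y` flips the sign of `φ x - φ y`; averaging leaves the even part, `cosh`.
  have e3 : ∑ x ∈ Ω, ∑ y ∈ Ω, G.w x y * (Real.exp (φ x - φ y) * (v x * v y))
      = ∑ x ∈ Ω, ∑ y ∈ Ω, G.w x y * (Real.cosh (φ x - φ y) * (v x * v y)) := by
    have h : ∑ x ∈ Ω, ∑ y ∈ Ω, G.w x y * (Real.exp (φ x - φ y) * (v x * v y))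
        = ∑ x ∈ Ω, ∑ y ∈ Ω, G.w x y * (Real.exp (-(φ x - φ y)) * (v x * v y)) := by
      rw [Finset.sum_comm]
      refine Finset.sum_congr rfl fun x _ => Finset.sum_congr rfl fun y _ => ?_
      rw [G.w_symm y x, neg_sub, mul_comm (v y)]
    have h2 : ∑ x ∈ Ω, ∑ y ∈ Ω, G.w x y * (Real.cosh (φ x - φ y) * (v x * v y))
        = (∑ x ∈ Ω, ∑ y ∈ Ω, G.w x y * (Real.exp (φ x - φ y) * (v x * v y))
          + ∑ x ∈ Ω, ∑ y ∈ Ω, G.w x y * (Real.exp (-(φ x - φ y)) * (v x * v y))) / 2 := by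
      simp only [← Finset.sum_add_distrib, Finset.sum_div]
      refine Finset.sum_congr rfl fun x _ => Finset.sum_congr rfl fun y _ => ?_
      rw [Real.cosh_eq]; ring
    rw [h2, ← h]; ring
  -- Termwise, `cosh (φ x - φ y) - 1` lies between `0` and `cosh l - 1`, and `v x * v y ≤ (v x ^ 2 +
  -- v y ^ 2) / 2`.
  have e4 : ∑ x ∈ Ω, ∑ y ∈ Ω, G.w x y * (Real.cosh (φ x - φ y) * (v x * v y))
      - ∑ x ∈ Ω, ∑ y ∈ Ω, G.w x y * (v x * v y)
      ≤ (Real.cosh l - 1) * ((∑ x ∈ Ω, ∑ y ∈ Ω, G.w x y * v x ^ 2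
        + ∑ x ∈ Ω, ∑ y ∈ Ω, G.w x y * v y ^ 2) / 2) := by
    simp only [← Finset.sum_add_distrib, ← Finset.sum_sub_distrib, Finset.sum_div, Finset.mul_sum]
    refine Finset.sum_le_sum fun x _ => Finset.sum_le_sum fun y _ => ?_
    rcases (G.w_nonneg x y).eq_or_lt with hw | hw
    · simp [← hw]
    · have h1 : Real.cosh (φ x - φ y) ≤ Real.cosh l :=
        Real.cosh_le_cosh.2 ((hφ x y hw).trans (le_abs_self l))
      have h2 := Real.one_le_cosh (φ x - φ y)
      have h3 : (Real.cosh (φ x - φ y) - 1) * (v x * v y)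
          ≤ (Real.cosh l - 1) * ((v x ^ 2 + v y ^ 2) / 2) := by
        calc _ ≤ (Real.cosh (φ x - φ y) - 1) * ((v x ^ 2 + v y ^ 2) / 2) :=
              mul_le_mul_of_nonneg_left (by nlinarith [sq_nonneg (v x - v y)]) (by linarith)
          _ ≤ _ := mul_le_mul_of_nonneg_right (by linarith) (by positivity)
      nlinarith [mul_le_mul_of_nonneg_left h3 hw.le]
  have h5 := G.sum_sum_w_mul_le Ω fun x => sq_nonneg (v x)
  have h6 : ∑ x ∈ Ω, ∑ y ∈ Ω, G.w x y * v y ^ 2 ≤ G.Dm * ∑ x ∈ Ω, G.m x * v x ^ 2 := by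
    rw [Finset.sum_comm]
    simpa only [G.w_symm] using h5
  have h7 := mul_le_mul_of_nonneg_left (a := Real.cosh l - 1) (add_le_add h5 h6)
    (sub_nonneg.2 (Real.one_le_cosh l))
  rw [e1, e3]
  rw [e2] at hμ
  linarith

end Energy

/-! ### Weighted energy along the Dirichlet heat flow -/

section Evolution

lemma laplacian_sum {ι : Type*} (s : Finset ι) (f : ι → V → ℝ) :
    G.laplacian (∑ i ∈ s, f i) = ∑ i ∈ s, G.laplacian (f i) :=
  map_sum (IsLinearMap.mk' G.laplacian ⟨G.laplacian_add, G.laplacian_smul⟩) f s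

/-- The Dirichlet heat semigroup on `Ω` applied to the indicator function of `F`. -/
noncomputable def dirichletHeat (Ω F : Finset V) (t : ℝ) (x : V) : ℝ :=
  ∑ y ∈ F, G.dirichletHeatKernel Ω t x y * G.m y

lemma dirichletHeat_eq_zero (Ω F : Finset V) (t : ℝ) {x : V} (hx : x ∉ Ω) :
    G.dirichletHeat Ω F t x = 0 :=
  Finset.sum_eq_zero fun y _ => by simp [dirichletHeatKernel, hx]

lemma hasDerivAt_dirichletHeat (Ω F : Finset V) (t : ℝ) {x : V} (hx : x ∈ Ω) :
    HasDerivAt (fun s => G.dirichletHeat Ω F s x) (G.laplacian (G.dirichletHeat Ω F t) x) t := by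
  have h : HasDerivAt (fun s => G.dirichletHeat Ω F s x)
      (∑ y ∈ F, G.laplacian (fun z => G.dirichletHeatKernel Ω t z y) x * G.m y) t :=
    HasDerivAt.fun_sum fun y _ => (G.hasDerivAt_dirichletHeatKernel Ω t hx y).mul_const _
  have e : G.dirichletHeat Ω F t
      = ∑ y ∈ F, G.m y • fun z => G.dirichletHeatKernel Ω t z y := by
    funext z
    simp [dirichletHeat, Finset.sum_apply, mul_comm]
  rw [e, laplacian_sum, Finset.sum_apply]
  simpa only [laplacian_smul, Pi.smul_apply, smul_eq_mul, mul_comm] using h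

open scoped Classical in
lemma dirichletHeat_zero (Ω F : Finset V) {x : V} (hx : x ∈ Ω) :
    G.dirichletHeat Ω F 0 x = if x ∈ F then 1 else 0 := by
  have hm : ∀ y, 1 / G.m y * G.m y = 1 := fun y => one_div_mul_cancel (G.m_pos y).ne'
  simp [dirichletHeat, G.dirichletHeatKernel_zero Ω hx, ite_mul, (G.m_pos _).ne']

variable [MeasurableSpace V] [DiscreteMeasurableSpace V]

/-- Growth of the weighted energy along the Dirichlet heat semigroup. -/
lemma weighted_energy_le (Ω F : Finset V) {φ : V → ℝ} {l : ℝ}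
    (hφ : ∀ x y, 0 < G.w x y → |φ x - φ y| ≤ l) {t : ℝ} (ht : 0 ≤ t) :
    ∑ x ∈ Ω, G.m x * (G.dirichletHeat Ω F t x * Real.exp (φ x)) ^ 2
      ≤ Real.exp (2 * (-G.spectralBottom + G.Dm * (Real.cosh l - 1)) * t)
        * ∑ x ∈ Ω, G.m x * (G.dirichletHeat Ω F 0 x * Real.exp (φ x)) ^ 2 := by
  set c := -G.spectralBottom + G.Dm * (Real.cosh l - 1)
  set E : ℝ → ℝ := fun s => ∑ x ∈ Ω, G.m x * (G.dirichletHeat Ω F s x * Real.exp (φ x)) ^ 2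
    with hE
  set E' : ℝ → ℝ := fun s => ∑ x ∈ Ω, G.m x * (G.laplacian (G.dirichletHeat Ω F s) x
    * G.dirichletHeat Ω F s x * Real.exp (φ x) ^ 2) with hE'
  have hd : ∀ s, HasDerivAt E (2 * E' s) s := fun s => by
    rw [hE', Finset.mul_sum]
    refine HasDerivAt.fun_sum fun x hx => ?_
    refine ((((G.hasDerivAt_dirichletHeat Ω F s hx).mul_const
      (Real.exp (φ x))).pow 2).const_mul (G.m x)).congr_deriv ?_
    simp only [Nat.cast_ofNat, Nat.add_one_sub_one, pow_one]
    ring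
  have hle : ∀ s, E' s ≤ c * E s := fun s =>
    G.sum_mul_laplacian_weighted_le (fun x hx => G.dirichletHeat_eq_zero Ω F s hx) hφ
  -- Grönwall with the integrating factor `exp (-(2 * c * s))`.
  have hd2 : ∀ s, HasDerivAt (fun s => Real.exp (-(2 * c * s)) * E s)
      (Real.exp (-(2 * c * s)) * (2 * (E' s - c * E s))) s := fun s => by
    refine ((((hasDerivAt_id s).const_mul (2 * c)).neg.exp).mul (hd s)).congr_deriv ?_
    simp only [Pi.neg_apply, id]
    ring
  have hanti : Antitone fun s => Real.exp (-(2 * c * s)) * E s := by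
    refine antitone_of_deriv_nonpos (fun s => (hd2 s).differentiableAt) fun s => ?_
    rw [(hd2 s).deriv]
    exact mul_nonpos_of_nonneg_of_nonpos (Real.exp_pos _).le (by linarith [hle s])
  have h := hanti ht
  simp only [mul_zero, neg_zero, Real.exp_zero, one_mul] at h
  calc E t = Real.exp (2 * c * t) * (Real.exp (-(2 * c * t)) * E t) := by
        rw [← mul_assoc, ← Real.exp_add, add_neg_cancel, Real.exp_zero, one_mul]
    _ ≤ _ := mul_le_mul_of_nonneg_left h (Real.exp_pos _).le

/-- The weight `exp (l * ρ)` equals 1 on `F₂`, so the initial energy is at most the mass of `F₂`. On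
`F₁` Cauchy-Schwarz pairs the weighted solution with `exp (-(l * ρ))`, which contributes the decay
`exp (-(l * d))`. -/
lemma sum_sum_dirichletHeatKernel_le (Ω F₁ F₂ : Finset V) {ρ : V → ℝ}
    (hρ : ∀ x y, 0 < G.w x y → |ρ x - ρ y| ≤ 1) (hρ₂ : ∀ y ∈ F₂, ρ y = 0) {d : ℝ}
    (hρ₁ : ∀ x ∈ F₁, d ≤ ρ x) {l : ℝ} (hl : 0 ≤ l) {t : ℝ} (ht : 0 ≤ t) :
    ∑ x ∈ F₁, ∑ y ∈ F₂, G.dirichletHeatKernel Ω t x y * G.m x * G.m y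
      ≤ Real.exp ((-G.spectralBottom + G.Dm * (Real.cosh l - 1)) * t - l * d)
        * √((∑ x ∈ F₁, G.m x) * ∑ y ∈ F₂, G.m y) := by
  classical
  set c := -G.spectralBottom + G.Dm * (Real.cosh l - 1)
  set u := G.dirichletHeat Ω F₂ t
  have hφ : ∀ x y, 0 < G.w x y → |l * ρ x - l * ρ y| ≤ l := fun x y hw => by
    rw [← mul_sub, abs_mul, abs_of_nonneg hl]
    exact mul_le_of_le_one_right hl (hρ x y hw)
  have hE := G.weighted_energy_le Ω F₂ hφ ht
  have hM₂ : ∑ x ∈ Ω, G.m x * (G.dirichletHeat Ω F₂ 0 x * Real.exp (l * ρ x)) ^ 2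
      ≤ ∑ y ∈ F₂, G.m y := by
    calc _ = ∑ x ∈ Ω, if x ∈ F₂ then G.m x else 0 := Finset.sum_congr rfl fun x hx => by
          rw [G.dirichletHeat_zero Ω F₂ hx]
          split_ifs with h <;> simp [h, hρ₂]
      _ = ∑ x ∈ Ω with x ∈ F₂, G.m x := (Finset.sum_filter _ _).symm
      _ ≤ _ := Finset.sum_le_sum_of_subset_of_nonneg (fun x hx => (Finset.mem_filter.1 hx).2)
          fun x _ _ => (G.m_pos x).le
  have hM₁ : ∑ x ∈ F₁, G.m x * Real.exp (-(l * ρ x)) ^ 2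
      ≤ Real.exp (-(l * d)) ^ 2 * ∑ x ∈ F₁, G.m x := by
    rw [Finset.mul_sum]
    refine Finset.sum_le_sum fun x hx => ?_
    rw [mul_comm]
    have := mul_le_mul_of_nonneg_left (hρ₁ x hx) hl
    have hm := (G.m_pos x).le
    gcongr
  -- `F₁` need not lie in `Ω`, but the solution vanishes off `Ω`.
  have hF : ∑ x ∈ F₁, G.m x * (u x * Real.exp (l * ρ x)) ^ 2
      ≤ ∑ x ∈ Ω, G.m x * (u x * Real.exp (l * ρ x)) ^ 2 := by
    have h : ∀ x, 0 ≤ G.m x * (u x * Real.exp (l * ρ x)) ^ 2 := fun x =>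
      mul_nonneg (G.m_pos x).le (sq_nonneg _)
    calc _ ≤ ∑ x ∈ F₁ ∪ Ω, G.m x * (u x * Real.exp (l * ρ x)) ^ 2 :=
          Finset.sum_le_sum_of_subset_of_nonneg Finset.subset_union_left fun x _ _ => h x
      _ = _ := (Finset.sum_subset Finset.subset_union_right fun x _ hx => by
          simp [u, G.dirichletHeat_eq_zero Ω F₂ t hx]).symm
  have hCS : (∑ x ∈ F₁, G.m x * u x) ^ 2
      ≤ (∑ x ∈ F₁, G.m x * Real.exp (-(l * ρ x)) ^ 2)
        * ∑ x ∈ F₁, G.m x * (u x * Real.exp (l * ρ x)) ^ 2 := by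
    refine Finset.sum_sq_le_sum_mul_sum_of_sq_le_mul _
      (fun x _ => mul_nonneg (G.m_pos x).le (sq_nonneg _))
      (fun x _ => mul_nonneg (G.m_pos x).le (sq_nonneg _)) fun x _ => le_of_eq ?_
    have h : Real.exp (-(l * ρ x)) * Real.exp (l * ρ x) = 1 := by
      rw [← Real.exp_add, neg_add_cancel, Real.exp_zero]
    calc _ = (G.m x * u x) ^ 2 * (Real.exp (-(l * ρ x)) * Real.exp (l * ρ x)) ^ 2 := by
          rw [h]; ring
      _ = _ := by ring
  have e : ∑ x ∈ F₁, ∑ y ∈ F₂, G.dirichletHeatKernel Ω t x y * G.m x * G.m y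
      = ∑ x ∈ F₁, G.m x * u x := by
    refine Finset.sum_congr rfl fun x _ => ?_
    simp only [u, dirichletHeat, Finset.mul_sum]
    exact Finset.sum_congr rfl fun y _ => by ring
  have h1 : 0 ≤ ∑ x ∈ F₁, G.m x := Finset.sum_nonneg fun x _ => (G.m_pos x).le
  have h2 : 0 ≤ ∑ x ∈ F₂, G.m x := Finset.sum_nonneg fun x _ => (G.m_pos x).le
  rw [e]
  rw [← Real.sqrt_sq (Real.exp_pos _).le, ← Real.sqrt_mul (sq_nonneg _)]
  refine Real.le_sqrt_of_sq_le (hCS.trans ?_)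
  calc _ ≤ (Real.exp (-(l * d)) ^ 2 * ∑ x ∈ F₁, G.m x)
        * (Real.exp (2 * c * t) * ∑ y ∈ F₂, G.m y) :=
        mul_le_mul hM₁ (hF.trans (hE.trans (mul_le_mul_of_nonneg_left hM₂ (Real.exp_pos _).le)))
          (Finset.sum_nonneg fun x _ => mul_nonneg (G.m_pos x).le (sq_nonneg _)) (by positivity)
    _ = _ := by
        rw [show 2 * c * t = c * t + c * t by ring, sub_eq_add_neg, Real.exp_add, Real.exp_add]
        ring

end Evolution

end WeightedGraph

/-! ### Hyperbolic inequalities and the optimal slope -/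

section Hyperbolic

lemma Real.sinh_le_mul_cosh {x : ℝ} (hx : 0 ≤ x) : Real.sinh x ≤ x * Real.cosh x := by
  have h : MonotoneOn (fun x => x * Real.cosh x - Real.sinh x) (Set.Ici 0) := by
    have hd : ∀ x : ℝ, HasDerivAt (fun x => x * Real.cosh x - Real.sinh x) (x * Real.sinh x) x :=
      fun x => (((hasDerivAt_id x).mul (Real.hasDerivAt_cosh x)).sub
        (Real.hasDerivAt_sinh x)).congr_deriv (by simp)
    refine monotoneOn_of_deriv_nonneg (convex_Ici 0)
      (fun x _ => (hd x).continuousAt.continuousWithinAt)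
      (fun x _ => (hd x).differentiableAt.differentiableWithinAt) fun x hx => ?_
    rw [interior_Ici, Set.mem_Ioi] at hx
    rw [(hd x).deriv]
    exact mul_nonneg hx.le (Real.sinh_nonneg_iff.2 hx.le)
  have := h Set.self_mem_Ici hx hx
  simp at this
  linarith

/-- By half-angle formulas this is `sinh y ≤ y * cosh y` at `y = x / 2`. In `Real.exists_slope` it
shows that the cost of the weight is at most half of its gain `l * d`. -/
lemma Real.cosh_sub_one_le {x : ℝ} (hx : 0 ≤ x) : Real.cosh x - 1 ≤ x * Real.sinh x / 2 := by
  have h := Real.sinh_le_mul_cosh (x := x / 2) (by positivity)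
  have hs : 0 ≤ Real.sinh (x / 2) := Real.sinh_nonneg_iff.2 (by positivity)
  have e1 : Real.cosh x = 1 + 2 * Real.sinh (x / 2) ^ 2 := by
    rw [show x = 2 * (x / 2) by ring, Real.cosh_two_mul, Real.cosh_sq]
    ring_nf
  have e2 : Real.sinh x = 2 * Real.sinh (x / 2) * Real.cosh (x / 2) := by
    rw [← Real.sinh_two_mul, mul_div_cancel₀ _ two_ne_zero]
  rw [e1, e2]
  nlinarith [mul_le_mul_of_nonneg_left h hs]

/-- `x ↦ arsinh x / x` is decreasing on the positive half-line. -/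
lemma Real.mul_arsinh_le_mul_arsinh {x y : ℝ} (hx : 0 ≤ x) (hxy : x ≤ y) :
    x * Real.arsinh y ≤ y * Real.arsinh x := by
  rcases (hx.trans hxy).eq_or_lt with hy | hy
  · simp [← hy, le_antisymm (hy ▸ hxy) hx]
  set θ := x / y with hθ
  have hθ0 : 0 ≤ θ := div_nonneg hx hy.le
  have hθ1 : θ ≤ 1 := (div_le_one hy).2 hxy
  -- This gives `sinh (θ * a) ≤ θ * sinh a`, to be used at `a = arsinh y`.
  have h : MonotoneOn (fun a => θ * Real.sinh a - Real.sinh (θ * a)) (Set.Ici 0) := by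
    have hd : ∀ a : ℝ, HasDerivAt (fun a => θ * Real.sinh a - Real.sinh (θ * a))
        (θ * (Real.cosh a - Real.cosh (θ * a))) a := fun a =>
      (((Real.hasDerivAt_sinh a).const_mul θ).sub
        (((hasDerivAt_id a).const_mul θ).sinh)).congr_deriv (by simp; ring)
    refine monotoneOn_of_deriv_nonneg (convex_Ici 0)
      (fun a _ => (hd a).continuousAt.continuousWithinAt)
      (fun a _ => (hd a).differentiableAt.differentiableWithinAt) fun a ha => ?_
    rw [interior_Ici, Set.mem_Ioi] at ha
    rw [(hd a).deriv]
    refine mul_nonneg hθ0 (sub_nonneg.2 (Real.cosh_le_cosh.2 ?_))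
    rw [abs_mul, abs_of_nonneg hθ0]
    exact mul_le_of_le_one_left (abs_nonneg a) hθ1
  have ha : 0 ≤ Real.arsinh y := Real.arsinh_nonneg_iff.2 hy.le
  have h1 := h Set.self_mem_Ici ha ha
  have hxe : x = θ * y := by rw [hθ]; field_simp
  simp only [Real.sinh_zero, mul_zero, sub_zero, Real.sinh_arsinh, ← hxe, sub_nonneg] at h1
  have h2 : θ * Real.arsinh y ≤ Real.arsinh x := by
    rwa [← Real.sinh_le_sinh, Real.sinh_arsinh]
  calc x * Real.arsinh y = y * (θ * Real.arsinh y) := by rw [hxe]; ring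
    _ ≤ _ := mul_le_mul_of_nonneg_left h2 hy.le

/-- The exponent in Davies' bound, optimized over the slope of the weight. -/
lemma Real.exists_slope {D β d t : ℝ} (hD : 0 < D) (hβ : 0 < β) (hd : 0 < d) (ht : β * d ≤ t) :
    ∃ l : ℝ, 0 ≤ l ∧ D * (Real.cosh l - 1) * t - l * d
      ≤ -(β * Real.arsinh (1 / (D * β))) * d ^ 2 / (4 * t) := by
  have ht0 : 0 < t := (mul_pos hβ hd).trans_le ht
  -- The exponent `D * (cosh l - 1) * t - l * d` is minimal where `sinh l = s`; the hypothesis `β *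
  -- d ≤ t` says `s ≤ 1 / (D * β)`.
  set s := d / (D * t) with hs
  have hs0 : 0 < s := by positivity
  have hss : s ≤ 1 / (D * β) := by
    rw [hs, div_le_div_iff₀ (by positivity) (by positivity)]
    nlinarith
  have hl : 0 ≤ Real.arsinh s := Real.arsinh_nonneg_iff.2 hs0.le
  refine ⟨Real.arsinh s, hl, ?_⟩
  have h1 := Real.cosh_sub_one_le hl
  rw [Real.sinh_arsinh] at h1
  have h2 := Real.mul_arsinh_le_mul_arsinh hs0.le hss
  have h3 : 0 ≤ Real.arsinh (1 / (D * β)) := Real.arsinh_nonneg_iff.2 (by positivity)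
  have hds : d = D * t * s := by rw [hs]; field_simp
  have h4 : D * β * (s * Real.arsinh (1 / (D * β))) ≤ Real.arsinh s := by
    calc _ ≤ D * β * (1 / (D * β) * Real.arsinh s) :=
          mul_le_mul_of_nonneg_left h2 (by positivity)
      _ = _ := by field_simp
  have e : -(β * Real.arsinh (1 / (D * β))) * d ^ 2 / (4 * t)
      = -(D * β * (s * Real.arsinh (1 / (D * β)))) * d / 4 := by
    rw [hs]; field_simp
  rw [e]
  calc _ ≤ D * (Real.arsinh s * s / 2) * t - Real.arsinh s * d := by gcongr
    _ = -(Real.arsinh s * d / 2) := by rw [hds]; ring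
    -- The target has `4 * t` in the denominator, so half of the available gain is given up.
    _ ≤ -(Real.arsinh s * d / 4) := by nlinarith [mul_nonneg hl hd.le]
    _ ≤ _ := by nlinarith [mul_le_mul_of_nonneg_right h4 hd.le]

end Hyperbolic

namespace WeightedGraph

variable {V : Type u} (G : WeightedGraph V)

/-! ### Distance to a set as a weight -/

section Distance

lemma setDist_le {B₁ B₂ : Set V} {x y : V} (hx : x ∈ B₁) (hy : y ∈ B₂) :
    G.setDist B₁ B₂ ≤ G.graph.dist x y :=
  Nat.sInf_le ⟨x, hx, y, hy, rfl⟩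

lemma exists_dist_eq_setDist {B₁ B₂ : Set V} (h₁ : B₁.Nonempty) (h₂ : B₂.Nonempty) :
    ∃ x ∈ B₁, ∃ y ∈ B₂, G.graph.dist x y = G.setDist B₁ B₂ := by
  obtain ⟨x, hx⟩ := h₁
  obtain ⟨y, hy⟩ := h₂
  exact Nat.sInf_mem (s := {n | ∃ x ∈ B₁, ∃ y ∈ B₂, G.graph.dist x y = n})
    ⟨_, x, hx, y, hy, rfl⟩

lemma dist_le_one {x y : V} (h : 0 < G.w x y) : G.graph.dist x y ≤ 1 := by
  by_cases hxy : x = y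
  · simp [hxy]
  · exact (SimpleGraph.dist_eq_one_iff_adj.2
      ((SimpleGraph.fromRel_adj _ _ _).2 ⟨hxy, Or.inl h⟩)).le

/-- Take a point of `B` nearest to `y` and reach it from `x` through the edge. -/
lemma setDist_singleton_le {x y : V} (h : 0 < G.w x y) {B : Set V} (hB : B.Nonempty) :
    G.setDist {x} B ≤ G.setDist {y} B + 1 := by
  obtain ⟨_, rfl, z, hz, h'⟩ := G.exists_dist_eq_setDist (Set.singleton_nonempty y) hB
  have hG : G.graph.Connected := G.connected
  rw [← h', add_comm]
  exact (G.setDist_le (Set.mem_singleton x) hz).trans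
    (hG.dist_triangle.trans (Nat.add_le_add_right (G.dist_le_one h) _))

lemma abs_setDist_singleton_sub_le {x y : V} (h : 0 < G.w x y) {B : Set V} (hB : B.Nonempty) :
    |(G.setDist {x} B : ℝ) - G.setDist {y} B| ≤ 1 := by
  have h1 : (G.setDist {x} B : ℝ) ≤ G.setDist {y} B + 1 := by
    exact_mod_cast G.setDist_singleton_le h hB
  have h2 : (G.setDist {y} B : ℝ) ≤ G.setDist {x} B + 1 := by
    exact_mod_cast G.setDist_singleton_le (G.w_symm x y ▸ h) hB
  exact abs_le.2 ⟨by linarith, by linarith⟩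

end Distance

/-! ### Passage to the minimal heat kernel and to arbitrary sets -/

section HeatKernelBound

variable [MeasurableSpace V] [DiscreteMeasurableSpace V]

lemma sum_le_measure {B : Set V} {F : Finset V} (hF : (F : Set V) ⊆ B) :
    ENNReal.ofReal (∑ x ∈ F, G.m x) ≤ G.measure B := by
  rw [measure, Measure.sum_apply _ MeasurableSet.of_discrete,
    ENNReal.ofReal_sum_of_nonneg fun x _ => (G.m_pos x).le]
  refine le_trans (Finset.sum_le_sum fun x hx => ?_) (ENNReal.sum_le_tsum F)
  simp [Set.indicator_of_mem (hF hx)]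

/-- The integrated heat kernel bound on finite sets. -/
lemma sum_sum_heatKernel_le {B₁ B₂ : Set V} {F₁ F₂ : Finset V} (hF₁ : (F₁ : Set V) ⊆ B₁)
    (hF₂ : (F₂ : Set V) ⊆ B₂) {l : ℝ} (hl : 0 ≤ l) {t : ℝ} (ht : 0 ≤ t) :
    ∑ x ∈ F₁, ∑ y ∈ F₂, G.heatKernel t x y * G.m x * G.m y
      ≤ Real.exp ((-G.spectralBottom + G.Dm * (Real.cosh l - 1)) * t - l * G.setDist B₁ B₂)
        * √((∑ x ∈ F₁, G.m x) * ∑ y ∈ F₂, G.m y) := by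
  rcases B₂.eq_empty_or_nonempty with hB | hB
  · have : F₂ = ∅ := by simpa [hB] using hF₂
    simp [this]
  -- The Dirichlet bound does not depend on `Ω`, so it survives the limit.
  refine le_of_tendsto' (tendsto_finsetSum _ fun x _ => tendsto_finsetSum _ fun y _ =>
    ((G.tendsto_heatKernel ht x y).mul_const _).mul_const _) fun Ω => ?_
  refine G.sum_sum_dirichletHeatKernel_le Ω F₁ F₂ (ρ := fun x => G.setDist {x} B₂)
    (fun x y h => G.abs_setDist_singleton_sub_le h hB) (fun y hy => ?_) (fun x hx => ?_) hl ht
  · have := G.setDist_le (B₁ := {y}) rfl (hF₂ hy)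
    rw [SimpleGraph.dist_self] at this
    exact_mod_cast Nat.le_zero.1 this
  · obtain ⟨_, rfl, z, hz, h'⟩ := G.exists_dist_eq_setDist (Set.singleton_nonempty x) hB
    rw [← h']
    exact_mod_cast G.setDist_le (hF₁ hx) hz

/-- Davies' bound with a free slope `l`. -/
lemma tsum_tsum_heatKernel_le (B₁ B₂ : Set V) {l : ℝ} (hl : 0 ≤ l) {t : ℝ} (ht : 0 ≤ t) :
    ∑' x : B₁, ∑' y : B₂, ENNReal.ofReal (G.heatKernel t x y * G.m x * G.m y)
      ≤ (G.measure B₁ * G.measure B₂) ^ (1 / 2 : ℝ) * ENNReal.ofReal (Real.exp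
        ((-G.spectralBottom + G.Dm * (Real.cosh l - 1)) * t - l * G.setDist B₁ B₂)) := by
  classical
  rw [← ENNReal.tsum_prod' (f := fun p : B₁ × B₂ =>
    ENNReal.ofReal (G.heatKernel t p.1 p.2 * G.m p.1 * G.m p.2)), ENNReal.tsum_eq_iSup_sum]
  refine iSup_le fun s => ?_
  -- A finite set of pairs lies in the product of its projections, and the terms are nonnegative.
  set F₁ := (s.image Prod.fst).map (Function.Embedding.subtype _)
  set F₂ := (s.image Prod.snd).map (Function.Embedding.subtype _)
  have hF₁ : (F₁ : Set V) ⊆ B₁ := fun x hx => by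
    obtain ⟨a, -, rfl⟩ := Finset.mem_map.1 hx
    exact a.2
  have hF₂ : (F₂ : Set V) ⊆ B₂ := fun x hx => by
    obtain ⟨a, -, rfl⟩ := Finset.mem_map.1 hx
    exact a.2
  have h0 : ∀ x y, 0 ≤ G.heatKernel t x y * G.m x * G.m y := fun x y =>
    mul_nonneg (mul_nonneg (G.heatKernel_nonneg ht x y) (G.m_pos x).le) (G.m_pos y).le
  have h1 : 0 ≤ ∑ x ∈ F₁, G.m x := Finset.sum_nonneg fun x _ => (G.m_pos x).le
  have h2 : 0 ≤ ∑ x ∈ F₂, G.m x := Finset.sum_nonneg fun x _ => (G.m_pos x).le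
  calc ∑ p ∈ s, ENNReal.ofReal (G.heatKernel t p.1 p.2 * G.m p.1 * G.m p.2)
      ≤ ∑ p ∈ s.image Prod.fst ×ˢ s.image Prod.snd,
          ENNReal.ofReal (G.heatKernel t p.1 p.2 * G.m p.1 * G.m p.2) :=
        Finset.sum_le_sum_of_subset Finset.subset_product
    _ = ENNReal.ofReal (∑ x ∈ F₁, ∑ y ∈ F₂, G.heatKernel t x y * G.m x * G.m y) := by
        rw [Finset.sum_product, ENNReal.ofReal_sum_of_nonneg fun x _ =>
          Finset.sum_nonneg fun y _ => h0 x y, Finset.sum_map]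
        refine Finset.sum_congr rfl fun x _ => ?_
        rw [ENNReal.ofReal_sum_of_nonneg fun y _ => h0 _ y, Finset.sum_map]
        rfl
    _ ≤ _ := ENNReal.ofReal_le_ofReal (G.sum_sum_heatKernel_le hF₁ hF₂ hl ht)
    _ ≤ _ := by
        rw [ENNReal.ofReal_mul (Real.exp_pos _).le, mul_comm, Real.sqrt_eq_rpow,
          ← ENNReal.ofReal_rpow_of_nonneg (mul_nonneg h1 h2) (by norm_num), ENNReal.ofReal_mul h1]
        gcongr
        · exact G.sum_le_measure hF₁
        · exact G.sum_le_measure hF₂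

/-- The integrated heat kernel bound with the full exponential decay rate `μ`. -/
lemma tsum_tsum_heatKernel_le_gaussian {β : ℝ} (hβ : 0 < β) (B₁ B₂ : Set V) {t : ℝ}
    (ht : β * G.setDist B₁ B₂ ≤ t) {C : ℝ}
    (hC : G.Dm ≠ 0 → C = β * Real.arsinh (1 / (G.Dm * β))) (hC0 : 0 ≤ C) :
    ∑' x : B₁, ∑' y : B₂, ENNReal.ofReal (G.heatKernel t x y * G.m x * G.m y)
      ≤ (G.measure B₁ * G.measure B₂) ^ (1 / 2 : ℝ) * ENNReal.ofReal (Real.exp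
        (-G.spectralBottom * t + -C * (G.setDist B₁ B₂ : ℝ) ^ 2 / (4 * t))) := by
  have ht0 : 0 ≤ t := le_trans (by positivity) ht
  have key : ∃ l : ℝ, 0 ≤ l ∧ G.Dm * (Real.cosh l - 1) * t - l * G.setDist B₁ B₂
      ≤ -C * (G.setDist B₁ B₂ : ℝ) ^ 2 / (4 * t) := by
    rcases (Nat.cast_nonneg (α := ℝ) (G.setDist B₁ B₂)).eq_or_lt with hd | hd
    -- This covers `t = 0`, where division by zero makes the exponent `0`.
    · exact ⟨0, le_rfl, by simp [← hd]⟩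
    · rcases G.Dm_nonneg.eq_or_lt with hD | hD
      -- With `Dm = 0` the weight costs nothing, so the slope can be read off from the target.
      · refine ⟨C * G.setDist B₁ B₂ / (4 * t), by positivity, le_of_eq ?_⟩
        rw [← hD]; ring
      · rw [hC hD.ne']
        exact Real.exists_slope hD hβ hd ht
  obtain ⟨l, hl, hle⟩ := key
  refine (G.tsum_tsum_heatKernel_le B₁ B₂ hl ht0).trans ?_
  gcongr
  linarith

end HeatKernelBound

end WeightedGraph

/-! ### The two estimates -/

theorem corollaryc :
    (∃ C₃ : ℝ → ℝ → ℝ → ℝ,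
      (∀ γ β D : ℝ, 0 < γ → γ < 1 → 0 < β → 0 ≤ D → 0 < C₃ γ β D) ∧
      ∀ γ β : ℝ, 0 < γ → γ < 1 → 0 < β →
        ∀ (V : Type u) [MeasurableSpace V] [DiscreteMeasurableSpace V] (G : WeightedGraph V)
          (B₁ B₂ : Set V) (t : ℝ), max (β * G.setDist B₁ B₂) 1 ≤ t →
          ∑' x : B₁, ∑' y : B₂, ENNReal.ofReal (G.heatKernel t x y * G.m x * G.m y) ≤
            ENNReal.ofReal (Real.exp (-(1 - γ) * G.spectralBottom * t)) *
              (G.measure B₁ * G.measure B₂) ^ (1 / 2 : ℝ) *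
              ENNReal.ofReal
                (Real.exp (-(C₃ γ β G.Dm) * (G.setDist B₁ B₂ : ℝ) ^ 2 / (4 * t)))) ∧
    (∀ β : ℝ, 0 < β →
      ∀ (V : Type u) [MeasurableSpace V] [DiscreteMeasurableSpace V] (G : WeightedGraph V)
        (B₁ B₂ : Set V) (t : ℝ), β * G.setDist B₁ B₂ ≤ t →
        ∑' x : B₁, ∑' y : B₂, ENNReal.ofReal (G.heatKernel t x y * G.m x * G.m y) ≤
          (G.measure B₁ * G.measure B₂) ^ (1 / 2 : ℝ) *
            ENNReal.ofReal
              (Real.exp (-(β * Real.arsinh (1 / (G.Dm * β))) *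
                (G.setDist B₁ B₂ : ℝ) ^ 2 / (4 * t)))) := by
  constructor
  -- At `D = 0` the formula evaluates to `β * arsinh 0 = 0`, which is not positive, hence the
  -- separate value.
  · refine ⟨fun _ β D => if D = 0 then 1 else β * Real.arsinh (1 / (D * β)),
      fun γ β D _ _ hβ hD => ?_, fun γ β hγ _ hβ V _ _ G B₁ B₂ t ht => ?_⟩
    · dsimp only
      split_ifs with h
      · exact one_pos
      · have hD : 0 < D := hD.lt_of_ne' h
        exact mul_pos hβ (Real.arsinh_pos_iff.2 (by positivity))
    · have hC : 0 ≤ if G.Dm = 0 then 1 else β * Real.arsinh (1 / (G.Dm * β)) := by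
        have := G.Dm_nonneg
        split_ifs
        · exact zero_le_one
        · exact mul_nonneg hβ.le (Real.arsinh_nonneg_iff.2 (by positivity))
      refine (G.tsum_tsum_heatKernel_le_gaussian hβ B₁ B₂ ((le_max_left _ _).trans ht)
        (fun h => if_neg h) hC).trans ?_
      -- Since `γ * μ * t ≥ 0`, the rate `μ` may be weakened to `(1 - γ) * μ`.
      have hμ := mul_nonneg (mul_nonneg hγ.le G.spectralBottom_nonneg)
        (zero_le_one.trans ((le_max_right _ _).trans ht))
      rw [Real.exp_add, ENNReal.ofReal_mul (Real.exp_pos _).le, ← mul_assoc, mul_comm (_ ^ _)]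
      gcongr ENNReal.ofReal (Real.exp ?_) * _ * _
      nlinarith
  · intro β hβ V _ _ G B₁ B₂ t ht
    have hC : 0 ≤ β * Real.arsinh (1 / (G.Dm * β)) := by
      have := G.Dm_nonneg
      exact mul_nonneg hβ.le (Real.arsinh_nonneg_iff.2 (by positivity))
    refine (G.tsum_tsum_heatKernel_le_gaussian hβ B₁ B₂ ht (fun _ => rfl) hC).trans ?_
    have hμ := mul_nonneg G.spectralBottom_nonneg (le_trans (by positivity) ht)
    gcongr
    linarith
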